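/- Let $(F_n)$ be the Fibonacci numbers, $F_0=0$, $F_1=1$, $F_{n+1}=F_n+F_{n-1}$, and $(G_n)$ the Pell numbers, $G_0=0$, $G_1=1$, $G_{n+1}=2G_n+G_{n-1}$. Let $k$ and $d$ be integers such that $\dfrac{4d^2}{k-d^2}$ is a negative integer. Then the negative Pell equation $p^2-kq^2=-1$ has no solutions in integers $p,q$, unless $(k,d)$ is one of the following exceptional pairs, where $s$ denotes an integer (positive or negative) and $n\ge 0$ an integer: - $k=5s^2$ and $d=3s$ or $d=5s$, where $2s$ divides $F_{2n+1}$ for some $n$; - $k=2s^2$ and $d=2s$, where $s$ divides $G_{2n+1}$ for some $n$. For each of these exceptional pairs, the equation $p^2-kq^2=-1$ does have a solution in integers. -/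

import Mathlib

/-- The Pell numbers: `G₀ = 0`, `G₁ = 1`, `Gₙ₊₂ = 2 Gₙ₊₁ + Gₙ`. -/
def pellNumber : ℕ → ℕ
  | 0 => 0
  | 1 => 1
  | n + 2 => 2 * pellNumber (n + 1) + pellNumber n

/-- The exceptional pairs `(k, d)`. The scale `s` is an integer of either sign, so that the pairs
`(k, d)` and `(k, -d)` are treated alike; `s ≠ 0` is automatic, since `s` divides a nonzero
integer. The Fibonacci numbers `Nat.fib` start with `F₀ = 0`, `F₁ = 1`. -/
def IsExceptionalPair (k d : ℤ) : Prop :=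
  (∃ (s : ℤ) (n : ℕ), k = 5 * s ^ 2 ∧ (d = 3 * s ∨ d = 5 * s) ∧
    2 * s ∣ (Nat.fib (2 * n + 1) : ℤ)) ∨
  (∃ (s : ℤ) (n : ℕ), k = 2 * s ^ 2 ∧ d = 2 * s ∧ s ∣ (pellNumber (2 * n + 1) : ℤ))

/-! Let `m > 0` be minus the given quotient, so `m k = (m - 4) d²`. A solution of `p² - k q² = -1`
yields `m (P² + 4) = (m - 4) Y²` with `P = 2p`, `Y = 2dq`. The unit `(m - 2 + √(m (m - 4))) / 2` of
norm 1 acts on such pairs, and descent (`exists_reduced_solution`) reaches `P² ≤ m - 4`, which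
leaves only `m = 5, 8, 9, 20, 36` (`eq_of_reduced_solution`). The last two force `4 ∣ k`, impossible
mod 4; the others give `k = 5s²` or `2s²`, where the solutions are Fibonacci or Pell numbers. -/

/-- Consecutive Fibonacci numbers satisfy Cassini's identity at even index. -/
theorem fib_two_mul_cassini (n : ℕ) :
    (Nat.fib (2 * n) : ℤ) ^ 2 + Nat.fib (2 * n) * Nat.fib (2 * n + 1)
      - (Nat.fib (2 * n + 1) : ℤ) ^ 2 = -1 := by
  induction n with
  | zero => simp
  | succ n ih =>
    have h1 : Nat.fib (2 * (n + 1)) = Nat.fib (2 * n) + Nat.fib (2 * n + 1) := Nat.fib_add_two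
    have h2 : Nat.fib (2 * (n + 1) + 1) = Nat.fib (2 * n + 1) + Nat.fib (2 * (n + 1)) :=
      Nat.fib_add_two
    rw [h2, h1]
    push_cast
    linear_combination ih

theorem pellNumber_two_mul_identity (n : ℕ) :
    (pellNumber (2 * n) : ℤ) ^ 2 + 2 * pellNumber (2 * n) * pellNumber (2 * n + 1)
      - (pellNumber (2 * n + 1) : ℤ) ^ 2 = -1 := by
  induction n with
  | zero => simp [pellNumber]
  | succ n ih =>
    have h1 : pellNumber (2 * (n + 1)) = 2 * pellNumber (2 * n + 1) + pellNumber (2 * n) := rfl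
    have h2 : pellNumber (2 * (n + 1) + 1)
        = 2 * pellNumber (2 * (n + 1)) + pellNumber (2 * n + 1) := rfl
    rw [h2, h1]
    push_cast
    linear_combination ih

/-- The nonnegative solutions of `a² - 5 b² = -4` are given by Fibonacci numbers of odd index. -/
theorem exists_fib_of_sq_add_four (N : ℕ) : ∀ a b : ℤ, 0 ≤ a → 0 < b → b ≤ N →
    a ^ 2 + 4 = 5 * b ^ 2 →
    ∃ n : ℕ, b = Nat.fib (2 * n + 1) ∧ a = 2 * Nat.fib (2 * n) + Nat.fib (2 * n + 1) := by
  induction N with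
  | zero => intro a b _ hb hbN; push_cast at hbN; omega
  | succ N ih =>
    intro a b ha hb hbN h
    push_cast at hbN
    rcases eq_or_lt_of_le (show 1 ≤ b by omega) with rfl | hb1
    · have : a = 1 := by nlinarith
      exact ⟨0, by simp, by simp [this]⟩
    have hpar : (a - b) % 2 = 0 := by
      have h1 : (a ^ 2 + 4) % 2 = (5 * b ^ 2) % 2 := by rw [h]
      rcases Int.emod_two_eq_zero_or_one a with h2 | h2 <;>
        rcases Int.emod_two_eq_zero_or_one b with h3 | h3 <;>
        simp [pow_two, Int.add_emod, Int.mul_emod, h2, h3] at h1 <;> omega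
    obtain ⟨c, hc⟩ : ∃ c, a = b + 2 * c := ⟨(a - b) / 2, by omega⟩
    subst hc
    have hc1 : 0 ≤ c - b + b := by nlinarith
    have hcb : c < b := by nlinarith
    have hlow : b ≤ 3 * c := by nlinarith
    -- Multiplication of `a + b√5` by the unit `(3 - √5) / 2`.
    obtain ⟨n, hn1, hn2⟩ := ih (3 * c - b) (b - c) (by omega) (by omega) (by
        have : 0 < c := by omega
        omega) (by linear_combination h)
    refine ⟨n + 1, ?_, ?_⟩
    all_goals
      have h1 : Nat.fib (2 * (n + 1)) = Nat.fib (2 * n) + Nat.fib (2 * n + 1) := Nat.fib_add_two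
      have h2 : Nat.fib (2 * (n + 1) + 1) = Nat.fib (2 * n + 1) + Nat.fib (2 * (n + 1)) :=
        Nat.fib_add_two
      omega

/-- The nonnegative solutions of `a² - 2 b² = -1` are given by Pell numbers of odd index. -/
theorem exists_pellNumber_of_sq_add_one (N : ℕ) : ∀ a b : ℤ, 0 ≤ a → 0 < b → b ≤ N →
    a ^ 2 + 1 = 2 * b ^ 2 →
    ∃ n : ℕ, b = pellNumber (2 * n + 1) ∧ a = pellNumber (2 * n) + pellNumber (2 * n + 1) := by
  induction N with
  | zero => intro a b _ hb hbN; push_cast at hbN; omega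
  | succ N ih =>
    intro a b ha hb hbN h
    push_cast at hbN
    rcases eq_or_lt_of_le (show 1 ≤ b by omega) with rfl | hb1
    · have : a = 1 := by nlinarith
      exact ⟨0, by simp [pellNumber], by simp [this, pellNumber]⟩
    have hab : b < a := by nlinarith
    have hup : 2 * a < 3 * b := by nlinarith
    have hlow : 4 * b ≤ 3 * a := by nlinarith
    -- Multiplication of `a + b√2` by the unit `3 - 2√2`.
    obtain ⟨n, hn1, hn2⟩ := ih (3 * a - 4 * b) (3 * b - 2 * a) (by omega) (by omega) (by omega)
      (by linear_combination h)
    refine ⟨n + 1, ?_, ?_⟩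
    all_goals
      have h1 : pellNumber (2 * (n + 1)) = 2 * pellNumber (2 * n + 1) + pellNumber (2 * n) := rfl
      have h2 : pellNumber (2 * (n + 1) + 1)
          = 2 * pellNumber (2 * (n + 1)) + pellNumber (2 * n + 1) := rfl
      omega

/-- Every solution of `m (P² + 4) = (m - 4) Y²` descends to one with `P² ≤ m - 4`. -/
theorem exists_reduced_solution {m : ℤ} (hm : 4 < m) (N : ℕ) : ∀ P Y : ℤ, 0 ≤ P → 0 ≤ Y →
    P ≤ N → m * (P ^ 2 + 4) = (m - 4) * Y ^ 2 →
    ∃ P Y : ℤ, 0 ≤ P ∧ 0 ≤ Y ∧ P ^ 2 ≤ m - 4 ∧ m * (P ^ 2 + 4) = (m - 4) * Y ^ 2 := by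
  induction N with
  | zero =>
    intro P Y hP hY hPN h
    push_cast at hPN
    obtain rfl : P = 0 := by omega
    exact ⟨0, Y, le_rfl, hY, by omega, h⟩
  | succ N ih =>
    intro P Y hP hY hPN h
    push_cast at hPN
    by_cases hred : P ^ 2 ≤ m - 4
    · exact ⟨P, Y, hP, hY, hred, h⟩
    push Not at hred
    have hPY : P < Y := by
      by_contra hle
      push Not at hle
      have : Y ^ 2 ≤ P ^ 2 := by gcongr
      nlinarith
    have hYP : (m - 4) * Y < m * P := by
      refine lt_of_pow_lt_pow_left₀ 2 (by positivity) ?_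
      have : ((m - 4) * Y) ^ 2 = (m - 4) * (m * (P ^ 2 + 4)) := by rw [h]; ring
      rw [this]
      nlinarith
    obtain ⟨c, hc⟩ : (2 : ℤ) ∣ m * (Y - P) := by
      rcases Int.emod_two_eq_zero_or_one m with h2 | h2
      · exact (Int.dvd_of_emod_eq_zero h2).mul_right _
      · refine Dvd.dvd.mul_left (Int.dvd_of_emod_eq_zero ?_) _
        have h1 : (m * (P ^ 2 + 4)) % 2 = ((m - 4) * Y ^ 2) % 2 := by rw [h]
        rcases Int.emod_two_eq_zero_or_one P with h3 | h3 <;>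
          rcases Int.emod_two_eq_zero_or_one Y with h4 | h4 <;>
          simp [pow_two, Int.add_emod, Int.sub_emod, Int.mul_emod, h2, h3, h4] at h1 <;> omega
    -- The new pair is `((m - 2)P - (m - 4)Y) / 2`, `((m - 2)Y - mP) / 2`; `hPY` and `hYP` say
    -- exactly that its first entry lies strictly between `-P` and `P`.
    have h' : m * ((2 * Y - P - c) ^ 2 + 4) = (m - 4) * (c - Y) ^ 2 := by
      linear_combination h + (4 * Y - 2 * c) * hc
    have hlt : |2 * Y - P - c| ≤ N := by
      rw [abs_le]
      constructor <;> nlinarith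
    exact ih _ _ (abs_nonneg _) (abs_nonneg _) hlt (by simpa only [sq_abs] using h')

/-- With `j = Y² - P² - 4`, reducedness gives `(m - 4) j ≤ 4 (m - 4) + 16`, so `j ≤ 20`; a bounded
gap between distinct squares bounds `P` and `Y`. -/
theorem eq_of_reduced_solution {m P Y : ℤ} (hm : 4 < m) (hP : 0 ≤ P) (hY : 0 ≤ Y)
    (hred : P ^ 2 ≤ m - 4) (h : m * (P ^ 2 + 4) = (m - 4) * Y ^ 2) :
    m = 5 ∨ m = 8 ∨ m = 9 ∨ m = 20 ∨ m = 36 := by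
  have hj : (m - 4) * (Y ^ 2 - P ^ 2 - 4) = 4 * (P ^ 2 + 4) := by linear_combination -h
  have hj0 : 0 < Y ^ 2 - P ^ 2 - 4 := by
    by_contra hle
    push Not at hle
    nlinarith
  have hj1 : Y ^ 2 - P ^ 2 - 4 ≤ 20 := by
    by_contra hlt
    push Not at hlt
    nlinarith
  have hPY : P + 1 ≤ Y := by nlinarith
  have hP12 : P ≤ 12 := by nlinarith
  have hY13 : Y ≤ 13 := by nlinarith
  interval_cases P <;> interval_cases Y <;> omega

theorem eq_of_solution {m p y : ℤ} (hm : 4 < m) (h : m * (p ^ 2 + 1) = (m - 4) * y ^ 2) :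
    m = 5 ∨ m = 8 ∨ m = 9 ∨ m = 20 ∨ m = 36 := by
  -- Doubling makes room for the denominator 2 of the unit.
  obtain ⟨P, Y, hP, hY, hred, h'⟩ := exists_reduced_solution hm (2 * p.natAbs) |2 * p| |2 * y|
    (abs_nonneg _) (abs_nonneg _) (by rw [abs_mul]; simp)
    (by simp only [sq_abs]; linear_combination 4 * h)
  exact eq_of_reduced_solution hm hP hY hred h'

theorem two_mul_dvd_fib_of_solution {s p q : ℤ} (h : p ^ 2 - 5 * s ^ 2 * q ^ 2 = -1) :
    ∃ n : ℕ, 2 * s ∣ (Nat.fib (2 * n + 1) : ℤ) := by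
  have hne : 2 * (s * q) ≠ 0 := by
    intro h0
    have : s * q = 0 := by omega
    have : s ^ 2 * q ^ 2 = 0 := by rw [← mul_pow, this]; rfl
    nlinarith [sq_nonneg p]
  obtain ⟨n, hn, -⟩ := exists_fib_of_sq_add_four (2 * (s * q)).natAbs |2 * p| |2 * (s * q)|
    (abs_nonneg _) (abs_pos.2 hne) (by simp) (by simp only [sq_abs]; linear_combination 4 * h)
  exact ⟨n, by rw [← hn, dvd_abs]; exact ⟨q, by ring⟩⟩

theorem dvd_pellNumber_of_solution {s p q : ℤ} (h : p ^ 2 - 2 * s ^ 2 * q ^ 2 = -1) :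
    ∃ n : ℕ, s ∣ (pellNumber (2 * n + 1) : ℤ) := by
  have hne : s * q ≠ 0 := by
    intro h0
    have : s ^ 2 * q ^ 2 = 0 := by rw [← mul_pow, h0]; rfl
    nlinarith [sq_nonneg p]
  obtain ⟨n, hn, -⟩ := exists_pellNumber_of_sq_add_one (s * q).natAbs |p| |s * q|
    (abs_nonneg _) (abs_pos.2 hne) (by simp) (by simp only [sq_abs]; linear_combination h)
  exact ⟨n, by rw [← hn, dvd_abs]; exact ⟨q, rfl⟩⟩

theorem negative_pell_ne_of_four_dvd {k p q : ℤ} (hk : 4 ∣ k) : p ^ 2 - k * q ^ 2 ≠ -1 := by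
  obtain ⟨c, rfl⟩ := hk
  intro h
  have h1 : p ^ 2 = 4 * (c * q ^ 2) - 1 := by linear_combination h
  rcases Int.even_or_odd' p with ⟨a, rfl | rfl⟩ <;> ring_nf at h1 <;> omega

theorem exists_solution_of_isExceptionalPair {k d : ℤ} (h : IsExceptionalPair k d) :
    ∃ p q : ℤ, p ^ 2 - k * q ^ 2 = -1 := by
  rcases h with ⟨s, n, rfl, -, c, hc⟩ | ⟨s, n, rfl, -, c, hc⟩
  · have h1 := fib_two_mul_cassini n
    rw [hc] at h1
    -- Completing the square in Cassini's identity, where `F₂ₙ₊₁ = 2sc`.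
    exact ⟨Nat.fib (2 * n) + s * c, c, by linear_combination h1⟩
  · have h1 := pellNumber_two_mul_identity n
    rw [hc] at h1
    exact ⟨pellNumber (2 * n) + s * c, c, by linear_combination h1⟩

theorem isExceptionalPair_of_solution {k d m p q : ℤ} (hm : 0 < m)
    (hd : d ≠ 0) (hmk : 4 * d ^ 2 = m * (d ^ 2 - k)) (h : p ^ 2 - k * q ^ 2 = -1) :
    IsExceptionalPair k d := by
  have hk : 0 < k := by
    by_contra hle
    push Not at hle
    nlinarith [mul_nonneg (neg_nonneg.2 hle) (sq_nonneg q), sq_nonneg p]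
  have hm4 : 4 < m := by
    have : 0 < d ^ 2 := by positivity
    by_contra hle
    push Not at hle
    nlinarith [mul_pos hm hk]
  have key : m * (p ^ 2 + 1) = (m - 4) * (d * q) ^ 2 := by
    linear_combination m * h + q ^ 2 * hmk
  rcases eq_of_solution hm4 key with rfl | rfl | rfl | rfl | rfl
  · obtain ⟨s, rfl⟩ : (5 : ℤ) ∣ d :=
      Int.Prime.dvd_pow' (n := d) (k := 2) (p := 5) (by norm_num) ⟨k, by push_cast; linarith⟩
    obtain rfl : k = 5 * s ^ 2 := by linarith
    obtain ⟨n, hn⟩ := two_mul_dvd_fib_of_solution h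
    exact Or.inl ⟨s, n, rfl, Or.inr rfl, hn⟩
  · obtain ⟨s, rfl⟩ : (2 : ℤ) ∣ d :=
      Int.Prime.dvd_pow' (n := d) (k := 2) (p := 2) (by norm_num) ⟨k, by push_cast; linarith⟩
    obtain rfl : k = 2 * s ^ 2 := by linarith
    obtain ⟨n, hn⟩ := dvd_pellNumber_of_solution h
    exact Or.inr ⟨s, n, rfl, rfl, hn⟩
  · obtain ⟨s, rfl⟩ : (3 : ℤ) ∣ d :=
      Int.Prime.dvd_pow' (n := d) (k := 2) (p := 3) (by norm_num) (by push_cast; omega)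
    obtain rfl : k = 5 * s ^ 2 := by linarith
    obtain ⟨n, hn⟩ := two_mul_dvd_fib_of_solution h
    exact Or.inl ⟨s, n, rfl, Or.inl rfl, hn⟩
  · exact absurd h (negative_pell_ne_of_four_dvd (by omega))
  · exact absurd h (negative_pell_ne_of_four_dvd (by omega))

theorem corollary6p8 (k d : ℤ)
    (hR : ∃ r : ℤ, r < 0 ∧ (4 * (d : ℚ) ^ 2) / ((k : ℚ) - (d : ℚ) ^ 2) = (r : ℚ)) :
    (¬ IsExceptionalPair k d → ¬ ∃ p q : ℤ, p ^ 2 - k * q ^ 2 = -1) ∧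
      (IsExceptionalPair k d → ∃ p q : ℤ, p ^ 2 - k * q ^ 2 = -1) := by
  refine ⟨?_, exists_solution_of_isExceptionalPair⟩
  rintro hne ⟨p, q, hpq⟩
  obtain ⟨r, hr, hrq⟩ := hR
  have hr0 : (r : ℚ) ≠ 0 := by exact_mod_cast hr.ne
  have hden : (k : ℚ) - (d : ℚ) ^ 2 ≠ 0 := by
    intro h0
    -- Division by zero gives 0, which is not negative.
    rw [h0, div_zero] at hrq
    exact hr0 hrq.symm
  have hd : d ≠ 0 := by
    rintro rfl
    apply hr0
    rw [← hrq]
    simp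
  rw [div_eq_iff hden] at hrq
  have hz : 4 * d ^ 2 = r * (k - d ^ 2) := by exact_mod_cast hrq
  exact hne (isExceptionalPair_of_solution (neg_pos.2 hr) hd (by linear_combination hz) hpq)
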